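/- Let $n\ge 1$, $R=[-1,1]^n$, $I=[p,q]\subset\mathbb R$ a compact interval, and let $f=f(x,y):\mathbb R^n\times\mathbb R\to\mathbb R$ be continuous. Put $\operatorname{sign}_y f(x,y)=1$ and $\Theta_y f(x,y)=1$ if $f(x,y)\ge 0$, and $\operatorname{sign}_y f(x,y)=-1$, $\Theta_y f(x,y)=0$ otherwise. Assume that for (almost) every $x\in R$ the function $y\mapsto\operatorname{sign}_y f(x,y)$ has exactly one jump discontinuity in $I$, i.e. exactly one point of $I$ where its two one-sided limits exist and differ. Let $g$ be the implicit function of $f=0$ in $R\times I$: for every $x\in R$, $g(x)\in I$ and $y=g(x)$ is the only solution $y\in I$ of $f(x,y)=0$. Assume that for some $\delta>0$ the function $g$ is the sum of a power series $g(x)=\sum_{\beta\in\mathbb N^n}c_\beta x^\beta$ centred at the origin which converges (absolutely) at every $x\in[-1-\delta,1+\delta]^n$. Let $\nu=1$ if $\operatorname{sign}_y f(x,\cdot)$ jumps upwards in $I$ (is increasing), and $\nu=-1$ if it jumps downwards (is decreasing); this does not depend on $x$, except when $p=q$, where the choice of $\nu$ is irrelevant. For $N\ge 1$ let $\Delta=2/N$,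 and for $\alpha\in\{1,\dots,N\}^n$ let $$R_\alpha=\prod_{k=1}^n[-1+(\alpha_k-1)\Delta,\,-1+\alpha_k\Delta],\qquad v_\alpha=\iint_{R_\alpha\times I}\Theta_y f(x,y)\,dx\,dy,$$ $$d_\alpha=\frac{1+\nu}2|R_\alpha|\,q+\frac{1-\nu}2|R_\alpha|\,p-\nu\,v_\alpha .$$ Let $V_N$ be the $N\times N$ matrix with entries $(-1+i\Delta)^j-(-1+(i-1)\Delta)^j$ ($1\le i,j\le N$), and let $W_N$ be the $n$-fold tensor whose $\alpha$th entry is $\alpha_1\cdots\alpha_n$. For a matrix $A$ and a tensor $C$, $A\stackrel{2\to k}{\cdot}C$ denotes the contraction of the second index of $A$ with the $k$th index of $C$, and $\circ$ the entrywise (Hadamard) product. Then: 1. For every $N\ge1$, $V_N$ is invertible, and there is exactly one polynomial $\tilde g_N(x)=\sum_{0\le\beta_1,\dots,\beta_n<N}\tilde c_\beta x^\beta$ with $\int_{R_\alpha}\tilde g_N\,dx=d_\alpha$ for all $\alpha$; its coefficient $\tilde c_\beta$ is the $(\beta+1)$th (that is, $(\beta_1+1,\dots,\beta_n+1)$th)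 entry of $$W_N\circ\Big[V_N^{-1}\stackrel{2\to n}{\cdot}\cdots V_N^{-1}\stackrel{2\to 2}{\cdot}V_N^{-1}\stackrel{2\to 1}{\cdot}(d_\alpha)_\alpha\Big].$$ 2. $\tilde g_N\to g$ weak-star in $L^\infty(R)$ as $N\to\infty$: all these functions are in $L^\infty(R)$, and $\int_R\tilde g_N\varphi\,dx\to\int_R g\varphi\,dx$ for every $\varphi\in L^1(R)$. -/

import Mathlib

open MeasureTheory Filter Topology Set

noncomputable section

namespace ImplicitWeakStar

/-- `sign_y f(x, ·)`: it is `1` where `f(x, y) ≥ 0` and `-1` otherwise. -/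
def signY {n : ℕ} (f : (Fin n → ℝ) × ℝ → ℝ) (x : Fin n → ℝ) (y : ℝ) : ℝ :=
  open Classical in if 0 ≤ f (x, y) then 1 else -1

/-- `Θ_y f(x, y)`, the Heaviside step function of `f`: `1` where `f ≥ 0` and `0` otherwise. -/
def heavisideY {n : ℕ} (f : (Fin n → ℝ) × ℝ → ℝ) (z : (Fin n → ℝ) × ℝ) : ℝ :=
  open Classical in if 0 ≤ f z then 1 else 0

/-- `h` has the left limit `l` and the right limit `r` at `y`. -/
def HasSideLimits (h : ℝ → ℝ) (y l r : ℝ) : Prop :=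
  Tendsto h (𝓝[<] y) (𝓝 l) ∧ Tendsto h (𝓝[>] y) (𝓝 r)

/-- `h` has a jump discontinuity at `y`: both one-sided limits exist and they differ. -/
def HasJumpAt (h : ℝ → ℝ) (y : ℝ) : Prop :=
  ∃ l r : ℝ, HasSideLimits h y l r ∧ l ≠ r

/-- An increasing jump. -/
def HasUpJumpAt (h : ℝ → ℝ) (y : ℝ) : Prop :=
  ∃ l r : ℝ, HasSideLimits h y l r ∧ l < r

/-- The cube `[-r, r]^n`. -/
def cube (n : ℕ) (r : ℝ) : Set (Fin n → ℝ) :=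
  Icc (fun _ => -r) (fun _ => r)

/-- `sign_y f(x, ·)` has exactly one jump discontinuity on `I = [p, q]`, for almost every
`x ∈ [-1, 1]^n`. A null set of exceptional `x` is allowed, so that the zero set of `f` may
touch the boundary of `I`, as for `f(x, y) = y ^ 2 - x ^ 4` on `[-1, 1] × [0, 1]` at `x = 0`. -/
def OneJump {n : ℕ} (f : (Fin n → ℝ) × ℝ → ℝ) (p q : ℝ) : Prop :=
  ∀ᵐ x ∂(volume.restrict (cube n 1)), ∃! y, y ∈ Icc p q ∧ HasJumpAt (signY f x) y

/-- `y = g(x)` is the implicit function of `f = 0` in `[-1, 1]^n × [p, q]`: for every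
`x ∈ [-1, 1]^n`, `g x` is the one and only zero of `f(x, ·)` in `[p, q]`. -/
def IsImplicitFunction {n : ℕ} (f : (Fin n → ℝ) × ℝ → ℝ) (p q : ℝ)
    (g : (Fin n → ℝ) → ℝ) : Prop :=
  ∀ x ∈ cube n 1, g x ∈ Icc p q ∧ ∀ y ∈ Icc p q, f (x, y) = 0 ↔ y = g x

/-- The monomial `x^β`. -/
def monomialFun {n : ℕ} (β : Fin n → ℕ) (x : Fin n → ℝ) : ℝ :=
  ∏ k, x k ^ β k

/-- `g` is the sum of a power series in `n` variables, centred at the origin, that converges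
(unconditionally) at every point of `[-r, r]^n`. -/
def HasPowerSeriesOnCube {n : ℕ} (g : (Fin n → ℝ) → ℝ) (r : ℝ) : Prop :=
  ∃ c : (Fin n → ℕ) → ℝ, ∀ x ∈ cube n r, HasSum (fun β => c β * monomialFun β x) (g x)

/-- The common value of `n_y(f)(x)`: `1` if `sign_y f(x, ·)` is increasing and `-1` if it is
decreasing; as this function is two-valued with a single jump on `I = [p, q]`, the direction
of the jump decides. -/
def orientation {n : ℕ} (f : (Fin n → ℝ) × ℝ → ℝ) (p q : ℝ) : ℝ :=
  open Classical in
  if ∃ x ∈ cube n 1, ∃ y ∈ Icc p q, HasUpJumpAt (signY f x) y then 1 else -1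

/-- The `i`-th partition point `-1 + i Δ` of `[-1, 1]`, `Δ = 2 / N`. -/
def gridPoint (N i : ℕ) : ℝ := -1 + i * (2 / N)

/-- The grid block `R_α`. Indices start at `0` here, so that `α k` stands for `α_k - 1`
when the blocks are numbered from `1` to `N` in each direction. -/
def gridBlock {n N : ℕ} (α : Fin n → Fin N) : Set (Fin n → ℝ) :=
  Icc (fun k => gridPoint N (α k)) (fun k => gridPoint N (α k + 1))

/-- `v_α`, the integral of `Θ_y f` over `R_α × [p, q]`. -/
def blockVolume {n N : ℕ} (f : (Fin n → ℝ) × ℝ → ℝ) (p q : ℝ) (α : Fin n → Fin N) : ℝ :=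
  ∫ z in gridBlock α ×ˢ Icc p q, heavisideY f z

/-- The data `d_α`, computed from `f` only. -/
def blockData {n : ℕ} (f : (Fin n → ℝ) × ℝ → ℝ) (p q : ℝ) (N : ℕ) (α : Fin n → Fin N) : ℝ :=
  (1 + orientation f p q) / 2 * volume.real (gridBlock α) * q
    + (1 - orientation f p q) / 2 * volume.real (gridBlock α) * p
    - orientation f p q * blockVolume f p q α

/-- The matrix `V_N` with centre `a = 0` on `[-1, 1]`; its entry in the row `i + 1` and the
column `j + 1` is `(-1 + (i + 1) Δ) ^ (j + 1) - (-1 + i Δ) ^ (j + 1)`. -/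
def vMatrix (N : ℕ) : Matrix (Fin N) (Fin N) ℝ :=
  Matrix.of fun i j =>
    gridPoint N (i + 1) ^ ((j : ℕ) + 1) - gridPoint N i ^ ((j : ℕ) + 1)

/-- The tensor contraction of the second index of `A` with the `k`-th index of `C`. -/
def contract {n N : ℕ} (A : Matrix (Fin N) (Fin N) ℝ) (k : Fin n)
    (C : (Fin n → Fin N) → ℝ) : (Fin n → Fin N) → ℝ :=
  fun β => ∑ i, A (β k) i * C (Function.update β k i)

/-- The tensor `W`, with entries `α_1 ⋯ α_n` for indices numbered from `1`. -/
def wTensor (n N : ℕ) : (Fin n → Fin N) → ℝ :=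
  fun α => ∏ k, (((α k : ℕ) : ℝ) + 1)

/-- The coefficient tensor: the Hadamard product of `W` with the contraction of `V_N⁻¹`
with the data in the index `1`, then in the index `2`, and so on up to the index `n`. -/
def coeffTensor {n : ℕ} (f : (Fin n → ℝ) × ℝ → ℝ) (p q : ℝ) (N : ℕ) : (Fin n → Fin N) → ℝ :=
  wTensor n N *
    (List.finRange n).foldl (fun C k => contract (vMatrix N)⁻¹ k C) (blockData f p q N)

/-- The polynomial with the coefficients `c_β`, `0 ≤ β_k < N`. -/
def tensorPoly {n N : ℕ} (c : (Fin n → Fin N) → ℝ) (x : Fin n → ℝ) : ℝ :=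
  ∑ β, c β * monomialFun (fun k => (β k : ℕ)) x

/-- The functions `u N` and `v` are in `L^∞(μ)` and `u N → v` weak-star in
`L^∞(μ) = L^1(μ)^*`, that is, when tested against every function in `L^1(μ)`. -/
def TendstoWeakStarLInfty {X : Type*} [MeasurableSpace X] (μ : Measure X)
    (u : ℕ → X → ℝ) (v : X → ℝ) : Prop :=
  (∀ N, MemLp (u N) ⊤ μ) ∧ MemLp v ⊤ μ ∧
    ∀ φ : X → ℝ, Integrable φ μ →
      Tendsto (fun N => ∫ x, u N x * φ x ∂μ) atTop (𝓝 (∫ x, v x * φ x ∂μ))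

end ImplicitWeakStar

end

noncomputable section

namespace ImplicitWeakStar

/-! Suppose `p < q`. For almost every `x`, `f(x, ·)` changes sign in `[p, q]` only at `g x`, and
always in the same direction, because the cube is connected. The fibre integral of `Θ` is then `q -
g x` throughout or `g x - p` throughout, and `d_α` is the integral of `g` over `R_α`
(`blockData_eq_setIntegral`, which also covers `p = q`).

The moment problem is linear and factors over the coordinates: its solution applies a Kronecker
power of `V_N⁻¹`. With `T_N` the one-variable solution operator (`gridApprox`), the series of `g`
yields `g̃_N = ∑ c_β ∏ T_N(x^β_k)`. Since `T_N(x^m) = x^m` once `N > m`, each term is eventually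
constant in `N`. Put `ρ = 1 + δ`. As `∑ |c_β| ρ^|β|` is finite, a bound `|T_N(x^m)| ≤ K ρ^m` on
`[-1, 1]` with `K` independent of `N` and `m` (`exists_gridApprox_bound`) supplies a summable
majorant. Dominated convergence gives bounded pointwise convergence, and a second use of it gives
weak-star convergence.

For that bound, matching integrals over cells means matching antiderivatives at the nodes up to a
constant. So `T_N(x^m)` is the derivative of the interpolant of `x^(m+1) / (m+1)` at `N + 1`
equispaced nodes. The interpolant of `X^M` is the remainder in `X^M = w Q + r`, with `w` the node
polynomial. Splitting off symmetric pairs of roots gives `|Q_j| ρ^j ≤ ρ^M / w(ρ)`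
(`exists_quotient_bound`). With `F = N! (2/N)^N`, on `[-1, 1]` one has `|w| ≤ 2F` and `|w'| ≤ (N+1)
F`, while `w(ρ) ≥ (ρ-1) F`, so `F` cancels. When `M > N` the factor `N + 1` is at most `M`, and `M =
m + 1` is divided out at the end. -/

/-! ### Division of a monomial by a polynomial with equispaced symmetric roots -/

open Polynomial in
/-- Dividing by `X ^ 2 - t ^ 2` keeps a geometric bound on the coefficients. -/
theorem abs_coeff_le_of_degree_sub_lt {ρ t K : ℝ} (hρ : 0 < ρ) (ht : t ^ 2 < ρ ^ 2)
    {P Q : ℝ[X]} (hdeg : (P - (X ^ 2 - C (t ^ 2)) * Q).degree < 2)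
    (hP : ∀ j, |P.coeff j| * ρ ^ j ≤ K) (j : ℕ) :
    |Q.coeff j| * ρ ^ j ≤ K / (ρ ^ 2 - t ^ 2) := by
  have hd : 0 < ρ ^ 2 - t ^ 2 := by linarith
  have hK : 0 ≤ K := le_trans (by positivity) (hP 0)
  -- Compare coefficients in degree `j + 2`, which the remainder does not reach.
  have hrec : ∀ j, Q.coeff j = P.coeff (j + 2) + t ^ 2 * Q.coeff (j + 2) := by
    intro j
    have h0 : (P - (X ^ 2 - C (t ^ 2)) * Q).coeff (j + 2) = 0 := by
      apply coeff_eq_zero_of_degree_lt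
      refine hdeg.trans_le ?_
      exact_mod_cast Nat.le_add_left 2 j
    rw [sub_mul, coeff_sub, coeff_sub, coeff_X_pow_mul, coeff_C_mul] at h0
    linarith
  -- Downward induction on `j` from above the degree of `Q`, in steps of two as in the recursion.
  -- The bound reproduces itself since `K + t² K / (ρ² - t²) = ρ² K / (ρ² - t²)`.
  have key : ∀ d j, Q.natDegree < j + d → |Q.coeff j| * ρ ^ j ≤ K / (ρ ^ 2 - t ^ 2) := by
    intro d
    induction d using Nat.twoStepInduction with
    | zero =>
      intro j hj
      rw [coeff_eq_zero_of_natDegree_lt (by simpa using hj)]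
      simp only [abs_zero, zero_mul]
      positivity
    | one =>
      intro j hj
      have h1 : |P.coeff (j + 2)| * ρ ^ (j + 2) ≤ K := hP _
      have h2 : Q.coeff (j + 2) = 0 := coeff_eq_zero_of_natDegree_lt (by omega)
      rw [hrec j, h2, mul_zero, add_zero, le_div_iff₀ hd]
      have h3 : 0 ≤ |P.coeff (j + 2)| * ρ ^ j := by positivity
      calc |P.coeff (j + 2)| * ρ ^ j * (ρ ^ 2 - t ^ 2)
          = |P.coeff (j + 2)| * ρ ^ (j + 2) - |P.coeff (j + 2)| * ρ ^ j * t ^ 2 := by ring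
        _ ≤ K := by linarith [mul_nonneg h3 (sq_nonneg t)]
    | more d h0 _ =>
      intro j hj
      have h1 : |P.coeff (j + 2)| * ρ ^ (j + 2) ≤ K := hP _
      have h2 := h0 (j + 2) (by omega)
      have h3 : |Q.coeff j| ≤ |P.coeff (j + 2)| + t ^ 2 * |Q.coeff (j + 2)| := by
        rw [hrec j]
        refine (abs_add_le _ _).trans_eq ?_
        rw [abs_mul, abs_of_nonneg (sq_nonneg t)]
      have h4 : |Q.coeff j| * ρ ^ j * ρ ^ 2 ≤ K + t ^ 2 * (K / (ρ ^ 2 - t ^ 2)) := by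
        calc |Q.coeff j| * ρ ^ j * ρ ^ 2
            ≤ (|P.coeff (j + 2)| + t ^ 2 * |Q.coeff (j + 2)|) * ρ ^ j * ρ ^ 2 := by gcongr
          _ = |P.coeff (j + 2)| * ρ ^ (j + 2) + t ^ 2 * (|Q.coeff (j + 2)| * ρ ^ (j + 2)) := by
              ring
          _ ≤ _ := by gcongr
      have h5 : K + t ^ 2 * (K / (ρ ^ 2 - t ^ 2)) = K / (ρ ^ 2 - t ^ 2) * ρ ^ 2 := by
        field_simp
        ring
      rw [h5] at h4
      exact le_of_mul_le_mul_right h4 (by positivity)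
  exact key (Q.natDegree + 1) j (by omega)

open Polynomial in
/-- The monic polynomial with the `m` roots `(2 i + 1 - m) c`, `i < m`. -/
def nodePoly (c : ℝ) (m : ℕ) : ℝ[X] :=
  ∏ i ∈ Finset.range m, (X - C ((2 * (i : ℝ) + 1 - m) * c))

-- The first and last factors are the new outer roots `∓(m + 1) c`; the factors between are the old
-- ones with the index shifted by one. Symmetry of the roots thus lets the node polynomial grow by
-- quadratic factors.
open Polynomial in
theorem nodePoly_add_two (c : ℝ) (m : ℕ) :
    nodePoly c (m + 2) = nodePoly c m * (X ^ 2 - C ((((m : ℝ) + 1) * c) ^ 2)) := by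
  unfold nodePoly
  rw [Finset.prod_range_succ, Finset.prod_range_succ']
  have h : ∀ i ∈ Finset.range m, (X - C ((2 * ((i + 1 : ℕ) : ℝ) + 1 - (m + 2 : ℕ)) * c) : ℝ[X]) =
      X - C ((2 * (i : ℝ) + 1 - m) * c) := by
    intro i _
    push_cast
    ring_nf
  rw [Finset.prod_congr rfl h, mul_assoc]
  congr 1
  have h1 : (2 * ((0 : ℕ) : ℝ) + 1 - (m + 2 : ℕ)) * c = -(((m : ℝ) + 1) * c) := by
    push_cast; ring
  have h2 : (2 * ((m + 1 : ℕ) : ℝ) + 1 - (m + 2 : ℕ)) * c = ((m : ℝ) + 1) * c := by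
    push_cast; ring
  rw [h1, h2, C_neg, C_pow]
  ring

open Polynomial in
theorem nodePoly_degree (c : ℝ) (m : ℕ) : (nodePoly c m).degree = m := by
  rw [nodePoly, degree_prod, Finset.sum_congr rfl fun i _ => degree_X_sub_C _]
  simp

open Polynomial in
/-- The quotient of `X ^ M` by the polynomial with equispaced symmetric roots
has geometrically bounded coefficients. -/
theorem exists_quotient_bound {ρ c : ℝ} (hρ : 0 < ρ) (hc : 0 ≤ c) (M m : ℕ)
    (hm : (m : ℝ) * c < ρ + c) :
    ∃ Q : ℝ[X], (X ^ M - nodePoly c m * Q).degree < (m : WithBot ℕ) ∧ 0 < (nodePoly c m).eval ρ ∧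
      ∀ j, |Q.coeff j| * ρ ^ j ≤ ρ ^ M / (nodePoly c m).eval ρ := by
  induction m using Nat.twoStepInduction with
  | zero =>
    refine ⟨X ^ M, by simp [nodePoly], by simp [nodePoly], fun j => ?_⟩
    rw [coeff_X_pow]
    split_ifs with h
    · simp [nodePoly, h]
    · simp [nodePoly]; positivity
  | one =>
    have h1 : nodePoly c 1 = X := by simp [nodePoly]
    rw [h1]
    rcases M with _ | M
    · refine ⟨0, by simp [degree_one], by simpa using hρ, fun j => ?_⟩
      simp only [coeff_zero, abs_zero, zero_mul, eval_X]; positivity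
    · refine ⟨X ^ M, ?_, by simpa using hρ, fun j => ?_⟩
      · rw [pow_succ', sub_self, degree_zero]; exact WithBot.bot_lt_coe _
      · rw [coeff_X_pow, eval_X, pow_succ, mul_div_assoc, div_self hρ.ne', mul_one]
        split_ifs with h
        · simp [h]
        · simp only [abs_zero, zero_mul]; positivity
  | more m h0 _ =>
    -- The new outer roots `±t` stay inside `(-ρ, ρ)`, so `ρ² - t²` is positive; these factors
    -- accumulate to the value of the node polynomial at `ρ`.
    have hm' : ((m : ℝ) + 1) * c < ρ := by push_cast at hm; linarith
    obtain ⟨P, hPd, hPρ, hP⟩ := h0 (by push_cast at hm; linarith)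
    have ht : (((m : ℝ) + 1) * c) ^ 2 < ρ ^ 2 := by
      apply pow_lt_pow_left₀ hm' (by positivity) (by norm_num)
    set t := ((m : ℝ) + 1) * c
    have hmon : (X ^ 2 - C (t ^ 2) : ℝ[X]).Monic := monic_X_pow_sub_C _ (by norm_num)
    have hd2 : (X ^ 2 - C (t ^ 2) : ℝ[X]).degree = 2 := degree_X_pow_sub_C (by norm_num) _
    have hrem : (P - (X ^ 2 - C (t ^ 2)) * (P /ₘ (X ^ 2 - C (t ^ 2)))).degree < 2 := by
      rw [← modByMonic_eq_sub_mul_div _, ← hd2]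
      exact degree_modByMonic_lt _ hmon
    refine ⟨P /ₘ (X ^ 2 - C (t ^ 2)), ?_, ?_, fun j => ?_⟩
    · rw [nodePoly_add_two]
      have h1 : X ^ M - nodePoly c m * (X ^ 2 - C (t ^ 2)) * (P /ₘ (X ^ 2 - C (t ^ 2))) =
          (X ^ M - nodePoly c m * P) +
            nodePoly c m * (P - (X ^ 2 - C (t ^ 2)) * (P /ₘ (X ^ 2 - C (t ^ 2)))) := by ring
      rw [h1]
      refine (degree_add_le _ _).trans_lt (max_lt (hPd.trans ?_) ?_)
      · exact_mod_cast Nat.lt_add_of_pos_right (by norm_num)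
      · rw [degree_mul, nodePoly_degree, Nat.cast_add]
        exact WithBot.add_lt_add_left (WithBot.natCast_ne_bot _) hrem
    · rw [nodePoly_add_two, eval_mul]
      refine mul_pos hPρ ?_
      simp only [eval_sub, eval_pow, eval_X, eval_C]
      linarith
    · refine (abs_coeff_le_of_degree_sub_lt hρ ht hrem hP j).trans_eq ?_
      rw [nodePoly_add_two, eval_mul, div_div]
      simp only [eval_sub, eval_pow, eval_X, eval_C]
      rfl

/-! ### Size of the node polynomial on `[-1, 1]` and at `ρ` -/

/-- For `y ∈ [0, N]`, the distances of `y` to the integers `0, …, N` have majorants that are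
at least `1` and whose product is at most `N!`. -/
theorem exists_majorant_abs_sub (N : ℕ) (y : ℝ) (h0 : 0 ≤ y) (hy : y ≤ N) :
    ∃ u : ℕ → ℝ, (∀ j ≤ N, 1 ≤ u j ∧ |y - j| ≤ u j) ∧
      ∏ j ∈ Finset.range (N + 1), u j ≤ (N.factorial : ℝ) := by
  induction N with
  | zero =>
    refine ⟨fun _ => 1, fun j hj => ⟨le_rfl, ?_⟩, by simp⟩
    have : y = 0 := le_antisymm (by simpa using hy) h0
    simp [this, Nat.le_zero.1 hj]
  | succ N ih =>
    push_cast at hy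
    by_cases hyN : y ≤ N
    · obtain ⟨u, hu, hp⟩ := ih hyN
      refine ⟨fun j => if j ≤ N then u j else N + 1, fun j hj => ?_, ?_⟩
      · by_cases h : j ≤ N
        · simpa [h] using hu j h
        · have : j = N + 1 := by omega
          subst this
          simp only [h, if_false]
          push_cast
          refine ⟨by linarith [Nat.cast_nonneg (α := ℝ) N], ?_⟩
          rw [abs_le]
          constructor <;> linarith
      · rw [Finset.prod_range_succ, Nat.factorial_succ]
        have : ∏ j ∈ Finset.range (N + 1), (if j ≤ N then u j else (N : ℝ) + 1) =
            ∏ j ∈ Finset.range (N + 1), u j := by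
          refine Finset.prod_congr rfl fun j hj => ?_
          rw [if_pos (by simpa [Nat.lt_succ_iff] using hj)]
        rw [this]
        simp only [Nat.not_succ_le_self, if_false, Nat.cast_mul, Nat.cast_add, Nat.cast_one]
        rw [mul_comm]
        gcongr
    · push Not at hyN
      refine ⟨fun j => if j ≤ N then N + 1 - j else 1, fun j hj => ?_, ?_⟩
      · by_cases h : j ≤ N
        · have h' : (j : ℝ) ≤ N := by exact_mod_cast h
          simp only [h, if_true]
          refine ⟨by linarith, ?_⟩
          rw [abs_le]
          constructor <;> linarith
        · have : j = N + 1 := by omega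
          subst this
          simp only [h, if_false]
          push_cast
          refine ⟨le_rfl, ?_⟩
          rw [abs_le]
          constructor <;> linarith
      · rw [Finset.prod_range_succ]
        have : ∏ j ∈ Finset.range (N + 1), (if j ≤ N then (N : ℝ) + 1 - j else 1) =
            ((N + 1).factorial : ℝ) := by
          rw [← Finset.prod_range_add_one_eq_factorial, Nat.cast_prod,
            ← Finset.prod_range_reflect]
          refine Finset.prod_congr rfl fun j hj => ?_
          have hj' : j ≤ N := by simpa [Nat.lt_succ_iff] using hj
          rw [if_pos (by omega)]
          have h2 : N + 1 - 1 - j = N - j := by omega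
          rw [h2, Nat.cast_sub hj']
          push_cast
          ring
        rw [this]
        simp

/-- Omitting a distance smaller than `1` would enlarge the product; omitting a majorant that is at
least `1` cannot. Such products are the summands of the derivative of the node polynomial. -/
theorem prod_erase_abs_sub_le (N : ℕ) (y : ℝ) (h0 : 0 ≤ y) (hy : y ≤ N) (i : ℕ)
    (hi : i ∈ Finset.range (N + 1)) :
    ∏ j ∈ (Finset.range (N + 1)).erase i, |y - j| ≤ (N.factorial : ℝ) := by
  obtain ⟨u, hu, hp⟩ := exists_majorant_abs_sub N y h0 hy
  have hu' : ∀ j ∈ Finset.range (N + 1), 1 ≤ u j ∧ |y - j| ≤ u j := fun j hj =>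
    hu j (by simpa [Nat.lt_succ_iff] using hj)
  calc ∏ j ∈ (Finset.range (N + 1)).erase i, |y - j|
      ≤ ∏ j ∈ (Finset.range (N + 1)).erase i, u j :=
        Finset.prod_le_prod (fun _ _ => abs_nonneg _)
          fun j hj => (hu' j (Finset.mem_of_mem_erase hj)).2
    _ ≤ u i * ∏ j ∈ (Finset.range (N + 1)).erase i, u j := by
        refine le_mul_of_one_le_left (Finset.prod_nonneg fun j hj => ?_) (hu' i hi).1
        linarith [(hu' j (Finset.mem_of_mem_erase hj)).1]
    _ = ∏ j ∈ Finset.range (N + 1), u j := Finset.mul_prod_erase _ _ hi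
    _ ≤ _ := hp

theorem gridPoint_eq {N : ℕ} (hN : 0 < N) (i : ℕ) :
    gridPoint N i = (2 * (i : ℝ) + 1 - (N + 1 : ℕ)) * (1 / N) := by
  have : (N : ℝ) ≠ 0 := by positivity
  unfold gridPoint
  push_cast
  field_simp
  ring

open Polynomial in
theorem nodePoly_eq_prod_gridPoint {N : ℕ} (hN : 0 < N) :
    nodePoly (1 / N) (N + 1) = ∏ i ∈ Finset.range (N + 1), (X - C (gridPoint N i)) :=
  Finset.prod_congr rfl fun i _ => by rw [gridPoint_eq hN]

theorem prod_erase_abs_sub_gridPoint_le {N : ℕ} (hN : 0 < N) {x : ℝ} (hx : |x| ≤ 1) (i : ℕ)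
    (hi : i ∈ Finset.range (N + 1)) :
    ∏ j ∈ (Finset.range (N + 1)).erase i, |x - gridPoint N j| ≤
      (N.factorial : ℝ) * (2 / N) ^ N := by
  have hN' : (0 : ℝ) < N := by exact_mod_cast hN
  obtain ⟨h1, h2⟩ := abs_le.1 hx
  have h := prod_erase_abs_sub_le N ((x + 1) * (N / 2)) (by
    have : 0 ≤ x + 1 := by linarith
    positivity) (by nlinarith) i hi
  have heq : ∀ j : ℕ, |x - gridPoint N j| = |(x + 1) * (N / 2) - j| * (2 / N) := by
    intro j
    rw [show |(x + 1) * (N / 2) - j| * (2 / N) = |((x + 1) * (N / 2) - j) * (2 / N)| by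
      rw [abs_mul, abs_of_pos (show (0 : ℝ) < 2 / N by positivity)]]
    unfold gridPoint
    congr 1
    field_simp
    ring
  simp_rw [heq]
  rw [Finset.prod_mul_distrib, Finset.prod_const, Finset.card_erase_of_mem hi, Finset.card_range,
    Nat.add_sub_cancel]
  gcongr

-- The last node `1` contributes `ρ - 1`; every other factor is at least the distance `(N - i) (2 /
-- N)` from its node to `1`, and these distances multiply to `N! (2/N)^N`.
open Polynomial in
theorem le_eval_nodePoly {N : ℕ} (hN : 0 < N) {ρ : ℝ} (hρ : 1 < ρ) :
    (ρ - 1) * ((N.factorial : ℝ) * (2 / N) ^ N) ≤ (nodePoly (1 / N) (N + 1)).eval ρ := by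
  have hN' : (0 : ℝ) < N := by exact_mod_cast hN
  rw [nodePoly_eq_prod_gridPoint hN, eval_prod, Finset.prod_range_succ, mul_comm]
  simp only [eval_sub, eval_X, eval_C]
  have h1 : gridPoint N N = 1 := by unfold gridPoint; field_simp; ring
  rw [h1]
  have h2 : (N.factorial : ℝ) * (2 / N) ^ N =
      ∏ i ∈ Finset.range N, ((N : ℝ) - i) * (2 / N) := by
    rw [Finset.prod_mul_distrib, Finset.prod_const, Finset.card_range,
      ← Finset.prod_range_add_one_eq_factorial, Nat.cast_prod, ← Finset.prod_range_reflect]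
    congr 1
    refine Finset.prod_congr rfl fun j hj => ?_
    have hj' := Finset.mem_range.1 hj
    have h3 : N - 1 - j + 1 = N - j := by omega
    rw [h3, Nat.cast_sub hj'.le]
  rw [h2]
  refine mul_le_mul_of_nonneg_right (Finset.prod_le_prod (fun i hi => ?_) fun i hi => ?_)
    (by linarith)
  · have : (i : ℝ) < N := by exact_mod_cast Finset.mem_range.1 hi
    have : (0 : ℝ) < N - i := by linarith
    positivity
  · have : gridPoint N i = 1 - ((N : ℝ) - i) * (2 / N) := by
      unfold gridPoint; field_simp; ring
    rw [this]; linarith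

/-! ### Interpolation of monomials at equispaced nodes -/

open Polynomial in
/-- The derivatives of the interpolating polynomials of the monomials at equispaced nodes
grow no faster than the derivatives of the monomials on a slightly larger interval. -/
theorem exists_interpolant_bound {ρ : ℝ} (hρ : 1 < ρ) :
    ∃ K : ℝ, 0 ≤ K ∧ ∀ N : ℕ, 0 < N → ∀ M : ℕ, 0 < M → ∃ r : ℝ[X], r.degree < (N + 1 : ℕ) ∧
      (∀ i ≤ N, r.eval (gridPoint N i) = gridPoint N i ^ M) ∧
      (∀ x : ℝ, |x| ≤ 1 → |r.derivative.eval x| ≤ K * M * ρ ^ M) ∧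
      (M ≤ N → r = X ^ M) := by
  have hρ0 : 0 < ρ := by linarith
  have hsum : Summable fun j : ℕ => ((j : ℝ) + 1) * (ρ⁻¹) ^ j := by
    have h1 : ‖ρ⁻¹‖ < 1 := by
      rw [Real.norm_of_nonneg (by positivity)]; exact inv_lt_one_of_one_lt₀ hρ
    have := (summable_pow_mul_geometric_of_norm_lt_one 1 h1).add
      (summable_geometric_of_norm_lt_one h1)
    refine this.congr fun j => ?_
    ring
  set S := ∑' j : ℕ, ((j : ℝ) + 1) * (ρ⁻¹) ^ j
  have hS : 0 ≤ S := tsum_nonneg fun j => by positivity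
  have hρ1 : 0 < ρ - 1 := by linarith
  -- The `1` pays for the derivative of `X^M`. For `M > N`, the term `w' Q` costs `M F` and `w Q'`
  -- costs `2 F ≤ 2 M F`, hence the `3`; `S` sums the geometric coefficient bounds of both `Q` and
  -- `Q'`.
  refine ⟨1 + 3 * S / (ρ - 1), by positivity, fun N hN M hM => ?_⟩
  have hN' : (0 : ℝ) < N := by exact_mod_cast hN
  have hM1 : (1 : ℝ) ≤ M := by exact_mod_cast hM
  have hmono : ∀ x : ℝ, |x| ≤ 1 → |(M : ℝ) * x ^ (M - 1)| ≤ M := by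
    intro x hx
    rw [abs_mul, abs_pow, Nat.abs_cast]
    exact mul_le_of_le_one_right (by positivity) (pow_le_one₀ (abs_nonneg x) hx)
  have hρM : 1 ≤ ρ ^ M := one_le_pow₀ hρ.le
  by_cases hMN : M ≤ N
  · refine ⟨X ^ M, ?_, by simp, fun x hx => ?_, fun _ => rfl⟩
    · rw [degree_X_pow]
      exact_mod_cast Nat.lt_succ_of_le hMN
    · simp only [derivative_X_pow, eval_mul, eval_C, eval_pow, eval_X]
      refine (hmono x hx).trans ?_
      have h1 : 1 ≤ 1 + 3 * S / (ρ - 1) := le_add_of_nonneg_right (by positivity)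
      calc (M : ℝ) = 1 * M * 1 := by ring
        _ ≤ _ := by gcongr
  · push Not at hMN
    obtain ⟨Q, hdeg, hpos, hQ⟩ := exists_quotient_bound (c := 1 / (N : ℝ)) hρ0 (by positivity) M
      (N + 1) (by push_cast; field_simp; nlinarith)
    have hD := le_eval_nodePoly hN hρ
    have hwe := nodePoly_eq_prod_gridPoint hN
    set w := nodePoly (1 / N) (N + 1)
    set F := (N.factorial : ℝ) * (2 / N) ^ N
    have hF : 0 < F := by positivity
    refine ⟨X ^ M - w * Q, hdeg, fun i hi => ?_, fun x hx => ?_, fun h => absurd h (by omega)⟩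
    · have : w.eval (gridPoint N i) = 0 := by
        rw [hwe, eval_prod]
        exact Finset.prod_eq_zero (Finset.mem_range.2 (Nat.lt_succ_of_le hi)) (by simp)
      simp [this]
    · have hcoef : ∀ j, |Q.coeff j| ≤ ρ ^ M / w.eval ρ * ρ⁻¹ ^ j := by
        intro j
        rw [inv_pow, ← div_eq_mul_inv, le_div_iff₀ (by positivity)]
        exact hQ j
      have hA : 0 ≤ ρ ^ M / w.eval ρ := by positivity
      have hsumle : ∑ j ∈ Finset.range (Q.natDegree + 1), ((j : ℝ) + 1) * ρ⁻¹ ^ j ≤ S :=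
        hsum.sum_le_tsum _ fun j _ => by positivity
      have hpow : ∀ j, |x| ^ j ≤ 1 := fun j => pow_le_one₀ (abs_nonneg x) hx
      have hQx : |Q.eval x| ≤ ρ ^ M / w.eval ρ * S := by
        rw [eval_eq_sum_range]
        refine (Finset.abs_sum_le_sum_abs _ _).trans
          (le_trans ?_ (mul_le_mul_of_nonneg_left hsumle hA))
        rw [Finset.mul_sum]
        refine Finset.sum_le_sum fun j _ => ?_
        rw [abs_mul, abs_pow]
        calc |Q.coeff j| * |x| ^ j ≤ ρ ^ M / w.eval ρ * ρ⁻¹ ^ j * 1 := by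
              gcongr
              · exact hcoef j
              · exact hpow j
          _ ≤ ρ ^ M / w.eval ρ * ρ⁻¹ ^ j * (j + 1) := by
              gcongr
              linarith [Nat.cast_nonneg (α := ℝ) j]
          _ = _ := by ring
      have hQ'x : |Q.derivative.eval x| ≤ ρ ^ M / w.eval ρ * S := by
        rw [derivative_eval, sum_over_range _ (by simp)]
        refine (Finset.abs_sum_le_sum_abs _ _).trans
          (le_trans ?_ (mul_le_mul_of_nonneg_left hsumle hA))
        rw [Finset.mul_sum]
        refine Finset.sum_le_sum fun j _ => ?_
        rw [abs_mul, abs_pow, abs_mul, Nat.abs_cast]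
        calc |Q.coeff j| * j * |x| ^ (j - 1) ≤ ρ ^ M / w.eval ρ * ρ⁻¹ ^ j * (j + 1) * 1 := by
              gcongr
              · exact hcoef j
              · linarith
              · exact hpow _
          _ = _ := by ring
      have hw'x : |w.derivative.eval x| ≤ M * F := by
        rw [hwe, derivative_prod_finset, eval_finsetSum]
        refine (Finset.abs_sum_le_sum_abs _ _).trans ?_
        refine (Finset.sum_le_card_nsmul _ _ F fun i hi => ?_).trans ?_
        · simp only [derivative_sub, derivative_X, derivative_C, sub_zero, mul_one, eval_prod,
            eval_sub, eval_X, eval_C, Finset.abs_prod]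
          exact prod_erase_abs_sub_gridPoint_le hN hx i hi
        · rw [Finset.card_range, nsmul_eq_mul]
          gcongr
          omega
      have hwx : |w.eval x| ≤ 2 * F := by
        have h0 : 0 ∈ Finset.range (N + 1) := by simp
        rw [hwe, eval_prod, Finset.abs_prod, ← Finset.mul_prod_erase _ _ h0]
        simp only [eval_sub, eval_X, eval_C]
        gcongr
        · obtain ⟨h1, h2⟩ := abs_le.1 hx
          simp only [gridPoint, Nat.cast_zero, zero_mul, add_zero]
          rw [abs_le]
          constructor <;> linarith
        · exact prod_erase_abs_sub_gridPoint_le hN hx 0 h0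
      have hAF : ρ ^ M / w.eval ρ * F ≤ ρ ^ M / (ρ - 1) := by
        rw [div_mul_eq_mul_div, div_le_div_iff₀ hpos hρ1]
        calc ρ ^ M * F * (ρ - 1) = ρ ^ M * ((ρ - 1) * F) := by ring
          _ ≤ _ := by gcongr
      simp only [derivative_sub, derivative_X_pow, derivative_mul, eval_sub, eval_add, eval_mul,
        eval_C, eval_pow, eval_X]
      have e1 : |w.derivative.eval x * Q.eval x| ≤ M * F * (ρ ^ M / w.eval ρ * S) := by
        rw [abs_mul]; gcongr
      have e2 : |w.eval x * Q.derivative.eval x| ≤ 2 * F * (ρ ^ M / w.eval ρ * S) := by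
        rw [abs_mul]; gcongr
      calc _ ≤ |(M : ℝ) * x ^ (M - 1)| + (|w.derivative.eval x * Q.eval x| +
            |w.eval x * Q.derivative.eval x|) :=
            (abs_sub _ _).trans (add_le_add_right (abs_add_le _ _) _)
        _ ≤ M + (M * F * (ρ ^ M / w.eval ρ * S) + 2 * F * (ρ ^ M / w.eval ρ * S)) := by
            gcongr
            exact hmono x hx
        _ = M + (M + 2) * S * (ρ ^ M / w.eval ρ * F) := by ring
        _ ≤ M * ρ ^ M + (M + 2 * M) * S * (ρ ^ M / (ρ - 1)) := by
            gcongr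
            · exact le_mul_of_one_le_right (by positivity) hρM
            · linarith
        _ = _ := by field_simp; ring

/-- The moment problem for a monomial: its solution represents a polynomial that is bounded on
`[-1, 1]` by the monomial at `ρ`, up to a factor, and equals the monomial for low degrees. -/
theorem exists_moment_solution {ρ : ℝ} (hρ : 1 < ρ) :
    ∃ K : ℝ, 0 ≤ K ∧ ∀ N : ℕ, 0 < N → ∀ m : ℕ, ∃ e : Fin N → ℝ,
      (∀ i, ∑ j, vMatrix N i j * e j =
        (gridPoint N (i + 1) ^ (m + 1) - gridPoint N i ^ (m + 1)) / (m + 1)) ∧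
      (∀ x : ℝ, |x| ≤ 1 → |∑ j : Fin N, ((j : ℕ) + 1 : ℝ) * e j * x ^ (j : ℕ)| ≤ K * ρ ^ m) ∧
      (m < N → ∀ x : ℝ, ∑ j : Fin N, ((j : ℕ) + 1 : ℝ) * e j * x ^ (j : ℕ) = x ^ m) := by
  obtain ⟨K, hK, h⟩ := exists_interpolant_bound hρ
  refine ⟨K * ρ, by positivity, fun N hN m => ?_⟩
  obtain ⟨r, hdeg, hint, hbd, hlow⟩ := h N hN (m + 1) (Nat.succ_pos m)
  have hm : ((m : ℝ) + 1) ≠ 0 := by positivity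
  have hnat : r.natDegree < N + 1 := by
    by_cases h0 : r = 0
    · simp [h0]
    · exact (Polynomial.natDegree_lt_iff_degree_lt h0).2 hdeg
  have hder : ∀ x : ℝ, ∑ j : Fin N, ((j : ℕ) + 1 : ℝ) * (r.coeff (j + 1) / (m + 1)) * x ^ (j : ℕ)
      = r.derivative.eval x / (m + 1) := by
    intro x
    rw [Polynomial.eval_eq_sum_range' (n := N), Finset.sum_div, Finset.sum_range]
    · refine Finset.sum_congr rfl fun j _ => ?_
      rw [Polynomial.coeff_derivative]
      ring
    · have := Polynomial.natDegree_derivative_le r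
      omega
  -- The coefficients of an antiderivative of the solution. Its constant term is left out, as it
  -- cancels in the differences; the weights `j + 1` differentiate it.
  refine ⟨fun j => r.coeff (j + 1) / (m + 1), fun i => ?_, fun x hx => ?_, fun hmN x => ?_⟩
  · have e : ∀ t : ℝ, r.eval t = r.coeff 0 + ∑ j : Fin N, r.coeff (j + 1) * t ^ ((j : ℕ) + 1) := by
      intro t
      rw [Polynomial.eval_eq_sum_range' hnat, Finset.sum_range_succ', Finset.sum_range]
      simp [add_comm]
    have h1 := hint (i + 1) (by omega)
    have h2 := hint i (by omega)
    rw [e] at h1 h2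
    rw [← h1, ← h2, add_sub_add_left_eq_sub, ← Finset.sum_sub_distrib, Finset.sum_div]
    refine Finset.sum_congr rfl fun j _ => ?_
    simp only [vMatrix, Matrix.of_apply]
    ring
  · rw [hder, abs_div, abs_of_pos (show (0 : ℝ) < m + 1 by positivity), div_le_iff₀ (by positivity)]
    refine (hbd x hx).trans_eq ?_
    push_cast
    ring
  · rw [hder, hlow hmN]
    simp only [Polynomial.derivative_X_pow, Polynomial.eval_mul, Polynomial.eval_C,
      Polynomial.eval_pow, Polynomial.eval_X]
    push_cast
    field_simp

/-! ### Tensor contractions as Kronecker products -/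

/-- The Kronecker product of the matrices `M k`, applied to the tensor `C`. -/
def kron {n N : ℕ} (M : Fin n → Matrix (Fin N) (Fin N) ℝ) (C : (Fin n → Fin N) → ℝ) :
    (Fin n → Fin N) → ℝ :=
  fun β => ∑ α, (∏ k, M k (β k) (α k)) * C α

theorem kron_one {n N : ℕ} (C : (Fin n → Fin N) → ℝ) :
    kron (fun _ => (1 : Matrix (Fin N) (Fin N) ℝ)) C = C := by
  funext β
  unfold kron
  rw [Finset.sum_eq_single β]
  · simp
  · intro α _ hα
    obtain ⟨k, hk⟩ := Function.ne_iff.1 hα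
    rw [Finset.prod_eq_zero (Finset.mem_univ k), zero_mul]
    exact Matrix.one_apply_ne (Ne.symm hk)
  · simp

theorem kron_kron {n N : ℕ} (A B : Fin n → Matrix (Fin N) (Fin N) ℝ) (C : (Fin n → Fin N) → ℝ) :
    kron A (kron B C) = kron (fun k => A k * B k) C := by
  funext β
  simp only [kron, Finset.mul_sum, Matrix.mul_apply, Fintype.prod_sum, Finset.sum_mul]
  rw [Finset.sum_comm]
  refine Finset.sum_congr rfl fun α _ => Finset.sum_congr rfl fun γ _ => ?_
  rw [Finset.prod_mul_distrib, mul_assoc]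

/-- The identity in slot `k` collapses the contracted sum to the single index `α k`, so `A` takes
its place. -/
theorem contract_kron {n N : ℕ} (A : Matrix (Fin N) (Fin N) ℝ) (k : Fin n)
    (M : Fin n → Matrix (Fin N) (Fin N) ℝ) (hM : M k = 1) (C : (Fin n → Fin N) → ℝ) :
    contract A k (kron M C) = kron (Function.update M k A) C := by
  funext β
  simp only [contract, kron, Finset.mul_sum]
  rw [Finset.sum_comm]
  refine Finset.sum_congr rfl fun α _ => ?_
  have h : ∀ i, ∏ l, M l (Function.update β k i l) (α l) =
      (1 : Matrix (Fin N) (Fin N) ℝ) i (α k) *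
        ∏ l ∈ Finset.univ.erase k, M l (β l) (α l) := by
    intro i
    rw [← Finset.mul_prod_erase _ _ (Finset.mem_univ k)]
    congr 1
    · rw [Function.update_self, hM]
    · refine Finset.prod_congr rfl fun l hl => ?_
      rw [Function.update_of_ne (Finset.ne_of_mem_erase hl)]
  have h' : ∏ l, Function.update M k A l (β l) (α l) =
      A (β k) (α k) * ∏ l ∈ Finset.univ.erase k, M l (β l) (α l) := by
    rw [← Finset.mul_prod_erase _ _ (Finset.mem_univ k)]
    congr 1
    · rw [Function.update_self]
    · refine Finset.prod_congr rfl fun l hl => ?_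
      rw [Function.update_of_ne (Finset.ne_of_mem_erase hl)]
  rw [h', Finset.sum_eq_single (α k)]
  · rw [h, Matrix.one_apply_eq]
    ring
  · intro i _ hi
    rw [h, Matrix.one_apply_ne hi]
    ring
  · simp

/-- Without repetitions in `l`, each slot still holds the identity when its turn comes. -/
theorem foldl_contract_kron {n N : ℕ} (A : Matrix (Fin N) (Fin N) ℝ) (C : (Fin n → Fin N) → ℝ)
    (l : List (Fin n)) (hl : l.Nodup) (M : Fin n → Matrix (Fin N) (Fin N) ℝ)
    (hM : ∀ k ∈ l, M k = 1) :
    l.foldl (fun C k => contract A k C) (kron M C) = kron (fun k => if k ∈ l then A else M k) C := by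
  induction l generalizing M with
  | nil => simp
  | cons a l ih =>
    obtain ⟨ha, hl'⟩ := List.nodup_cons.1 hl
    rw [List.foldl_cons, contract_kron A a M (hM a (by simp)), ih hl']
    · congr 1
      funext k
      by_cases hk : k = a
      · subst hk; simp
      · simp [hk]
    · intro k hk
      rw [Function.update_of_ne (by rintro rfl; exact ha hk)]
      exact hM k (by simp [hk])

theorem foldl_contract_finRange {n N : ℕ} (A : Matrix (Fin N) (Fin N) ℝ)
    (C : (Fin n → Fin N) → ℝ) :
    (List.finRange n).foldl (fun C k => contract A k C) C = kron (fun _ => A) C := by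
  conv_lhs => rw [← kron_one C]
  rw [foldl_contract_kron A C _ (List.nodup_finRange n) _ fun _ _ => rfl]
  simp

/-! ### Unique solvability of the moment problem on the grid -/

theorem gridPoint_strictMono {N : ℕ} (hN : 0 < N) : StrictMono (gridPoint N) := by
  intro i j hij
  have hN' : (0 : ℝ) < N := by exact_mod_cast hN
  have : (i : ℝ) < j := by exact_mod_cast hij
  unfold gridPoint
  gcongr

theorem gridPoint_zero (N : ℕ) : gridPoint N 0 = -1 := by simp [gridPoint]

theorem gridPoint_self {N : ℕ} (hN : 0 < N) : gridPoint N N = 1 := by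
  have hN' : (N : ℝ) ≠ 0 := by positivity
  unfold gridPoint
  field_simp
  ring

-- A kernel vector is the coefficient vector of a polynomial of degree at most `N`, without constant
-- term, that takes one value at all `N + 1` grid points. Such a polynomial is constant, hence zero.
open Polynomial in
theorem isUnit_vMatrix {N : ℕ} (hN : 0 < N) : IsUnit (vMatrix N) := by
  rw [← Matrix.mulVec_injective_iff_isUnit, ← Matrix.coe_mulVecLin, injective_iff_map_eq_zero]
  intro v hv
  set s : ℝ[X] := ∑ j : Fin N, C (v j) * X ^ ((j : ℕ) + 1)
  have hstep : ∀ i : ℕ, i ≤ N → s.eval (gridPoint N i) = s.eval (gridPoint N 0) := by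
    intro i
    induction i with
    | zero => simp
    | succ i ih =>
      intro hi
      rw [← ih (by omega), ← sub_eq_zero]
      have := congrFun hv ⟨i, hi⟩
      simp only [Matrix.mulVecLin_apply, Matrix.mulVec, dotProduct, vMatrix, Matrix.of_apply,
        Pi.zero_apply] at this
      simp only [s, eval_finsetSum, eval_mul, eval_C, eval_pow, eval_X]
      rw [← Finset.sum_sub_distrib, ← this]
      exact Finset.sum_congr rfl fun j _ => by ring
  have hdeg : s.natDegree ≤ N := natDegree_sum_le_of_forall_le _ _ fun j _ =>
    (natDegree_C_mul_X_pow_le _ _).trans (by omega)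
  have h0 : s - C (s.eval (gridPoint N 0)) = 0 := by
    refine eq_zero_of_natDegree_lt_card_of_eval_eq_zero _ (f := fun i : Fin (N + 1) => gridPoint N i)
      (fun i j hij => Fin.ext ((gridPoint_strictMono hN).injective hij)) (fun i => ?_) ?_
    · simp [hstep i (by omega)]
    · rw [Fintype.card_fin]
      exact Nat.lt_succ_of_le ((natDegree_sub_C).trans_le hdeg)
  funext j
  have hc : s.coeff ((j : ℕ) + 1) = v j := by
    simp only [s, finsetSum_coeff, coeff_C_mul, coeff_X_pow, add_left_inj]
    rw [Finset.sum_eq_single j]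
    · simp
    · intro i _ hi
      rw [if_neg fun h => hi (Fin.ext h.symm), mul_zero]
    · simp
  rw [sub_eq_zero] at h0
  rw [← hc, h0, coeff_C_of_ne_zero (by omega), Pi.zero_apply]

theorem continuous_monomialFun {n : ℕ} (β : Fin n → ℕ) : Continuous (monomialFun β) :=
  continuous_finsetProd _ fun k _ => (continuous_apply k).pow _

theorem continuous_tensorPoly {n N : ℕ} (c : (Fin n → Fin N) → ℝ) : Continuous (tensorPoly c) :=
  continuous_finsetSum _ fun _ _ => continuous_const.mul (continuous_monomialFun _)

/-- The integral of `x ^ m` over the `i`-th interval of the grid. -/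
def gridMoment (N m i : ℕ) : ℝ :=
  (gridPoint N (i + 1) ^ (m + 1) - gridPoint N i ^ (m + 1)) / (m + 1)

theorem setIntegral_monomialFun {n N : ℕ} (α : Fin n → Fin N) (β : Fin n → ℕ) :
    ∫ x in gridBlock α, monomialFun β x = ∏ k, gridMoment N (β k) (α k) := by
  unfold gridBlock monomialFun
  rw [← pi_univ_Icc, volume_pi, Measure.restrict_pi_pi,
    integral_fintype_prod_eq_prod (fun k (t : ℝ) => t ^ β k)]
  refine Finset.prod_congr rfl fun k _ => ?_
  have hN : 0 < N := (α k).pos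
  rw [integral_Icc_eq_integral_Ioc, ← intervalIntegral.integral_of_le
    ((gridPoint_strictMono hN).monotone (Nat.le_succ _)), integral_pow]
  rfl

theorem gridBlock_isCompact {n N : ℕ} (α : Fin n → Fin N) : IsCompact (gridBlock α) :=
  isCompact_Icc

theorem gridBlock_subset_cube {n N : ℕ} (α : Fin n → Fin N) : gridBlock α ⊆ cube n 1 := by
  intro x hx
  refine ⟨fun k => ?_, fun k => ?_⟩
  · have hm := (gridPoint_strictMono (α k).pos).monotone (Nat.zero_le (α k))
    rw [gridPoint_zero] at hm
    exact hm.trans (hx.1 k)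
  · have hm := (gridPoint_strictMono (α k).pos).monotone (Nat.succ_le_of_lt (α k).isLt)
    rw [gridPoint_self (α k).pos] at hm
    exact (hx.2 k).trans hm

/-- Integration divides by `β_k + 1` in each coordinate, which is the division by `W`; what remains
are differences of powers, the entries of `V_N`. -/
theorem setIntegral_tensorPoly {n N : ℕ} (c : (Fin n → Fin N) → ℝ) (α : Fin n → Fin N) :
    ∫ x in gridBlock α, tensorPoly c x =
      kron (fun _ => vMatrix N) (fun β => c β / wTensor n N β) α := by
  unfold tensorPoly
  rw [integral_finsetSum]
  · refine Finset.sum_congr rfl fun β _ => ?_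
    rw [integral_const_mul, setIntegral_monomialFun]
    simp only [gridMoment, Finset.prod_div_distrib, wTensor, vMatrix, Matrix.of_apply]
    ring
  · intro β _
    exact ((continuous_const.mul (continuous_monomialFun _)).continuousOn.integrableOn_compact
      (gridBlock_isCompact α))

theorem wTensor_pos {n N : ℕ} (β : Fin n → Fin N) : 0 < wTensor n N β :=
  Finset.prod_pos fun _ _ => by positivity

/-- The moment problem on the grid has a unique solution. -/
theorem setIntegral_tensorPoly_eq_iff {n N : ℕ} (hN : 0 < N) (c d : (Fin n → Fin N) → ℝ) :
    (∀ α, ∫ x in gridBlock α, tensorPoly c x = d α) ↔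
      c = wTensor n N * kron (fun _ => (vMatrix N)⁻¹) d := by
  have hdet := (Matrix.isUnit_iff_isUnit_det _).1 (isUnit_vMatrix hN)
  simp_rw [setIntegral_tensorPoly, ← funext_iff (f := kron _ _)]
  constructor
  · rintro rfl
    rw [kron_kron, Matrix.nonsing_inv_mul _ hdet, kron_one]
    funext β
    rw [Pi.mul_apply, mul_div_cancel₀ _ (wTensor_pos β).ne']
  · rintro rfl
    have : (fun β => (wTensor n N * kron (fun _ => (vMatrix N)⁻¹) d) β / wTensor n N β) =
        kron (fun _ => (vMatrix N)⁻¹) d := by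
      funext β
      rw [Pi.mul_apply, mul_div_cancel_left₀ _ (wTensor_pos β).ne']
    rw [this, kron_kron, Matrix.mul_nonsing_inv _ hdet, kron_one]

/-- The Kronecker product of a matrix with itself acts factorwise on elementary tensors. -/
theorem kron_prod {n N : ℕ} (A : Matrix (Fin N) (Fin N) ℝ) (u : Fin n → Fin N → ℝ)
    (β : Fin n → Fin N) :
    kron (fun _ => A) (fun α => ∏ k, u k (α k)) β = ∏ k, (A.mulVec (u k)) (β k) := by
  simp only [kron, Matrix.mulVec, dotProduct, Fintype.prod_sum, Finset.prod_mul_distrib]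

/-! ### From sign changes of `f` to block integrals of `g` -/

theorem pos_of_pos_of_ne_zero {φ : ℝ → ℝ} (hφ : Continuous φ) {S : Set ℝ} (hS : IsPreconnected S)
    (h0 : ∀ t ∈ S, φ t ≠ 0) {a : ℝ} (ha : a ∈ S) (hpos : 0 < φ a) : ∀ t ∈ S, 0 < φ t := by
  intro t ht
  by_contra hneg
  obtain ⟨s, hs, hs0⟩ := hS.intermediate_value ht ha hφ.continuousOn
    (show (0 : ℝ) ∈ Icc (φ t) (φ a) from ⟨not_lt.1 hneg, hpos.le⟩)
  exact h0 s hs hs0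

theorem neg_of_neg_of_ne_zero {φ : ℝ → ℝ} (hφ : Continuous φ) {S : Set ℝ} (hS : IsPreconnected S)
    (h0 : ∀ t ∈ S, φ t ≠ 0) {a : ℝ} (ha : a ∈ S) (hneg : φ a < 0) : ∀ t ∈ S, φ t < 0 := by
  intro t ht
  have := pos_of_pos_of_ne_zero hφ.neg hS (fun s hs => neg_ne_zero.2 (h0 s hs)) ha
    (neg_pos.2 hneg) t ht
  exact neg_pos.1 this

section Jump

variable {n : ℕ} {f : (Fin n → ℝ) × ℝ → ℝ} {p q : ℝ} {g : (Fin n → ℝ) → ℝ} {x : Fin n → ℝ}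

theorem signY_of_nonneg {y : ℝ} (h : 0 ≤ f (x, y)) : signY f x y = 1 := by simp [signY, h]

theorem signY_of_neg {y : ℝ} (h : f (x, y) < 0) : signY f x y = -1 := by
  simp [signY, not_le.2 h]

theorem signY_mem_Icc (y : ℝ) : signY f x y ∈ Icc (-1 : ℝ) 1 := by
  unfold signY
  split_ifs <;> norm_num

theorem continuous_section (hf : Continuous f) (x : Fin n → ℝ) : Continuous fun y => f (x, y) :=
  hf.comp (by fun_prop)

/-- The side limits of the sign at a point where `f(x, ·)` does not vanish are equal. -/
theorem eq_zero_of_hasJumpAt (hf : Continuous f) {y : ℝ} (h : HasJumpAt (signY f x) y) :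
    f (x, y) = 0 := by
  obtain ⟨l, r, ⟨hl, hr⟩, hne⟩ := h
  by_contra h0
  apply hne
  have hc : ∃ c, ∀ᶠ t in 𝓝 y, signY f x t = c := by
    rcases lt_or_gt_of_ne h0 with h | h
    · exact ⟨-1, ((continuous_section hf x).tendsto y |>.eventually_lt_const h).mono
        fun t ht => signY_of_neg ht⟩
    · exact ⟨1, ((continuous_section hf x).tendsto y |>.eventually_const_lt h).mono
        fun t ht => signY_of_nonneg (le_of_lt ht)⟩
  obtain ⟨c, hc⟩ := hc
  have hcl : Tendsto (signY f x) (𝓝[<] y) (𝓝 c) :=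
    tendsto_const_nhds.congr' ((hc.filter_mono nhdsWithin_le_nhds).mono fun t ht => ht.symm)
  have hcr : Tendsto (signY f x) (𝓝[>] y) (𝓝 c) :=
    tendsto_const_nhds.congr' ((hc.filter_mono nhdsWithin_le_nhds).mono fun t ht => ht.symm)
  rw [tendsto_nhds_unique hl hcl, tendsto_nhds_unique hr hcr]

theorem HasSideLimits.mem_Icc {y l r : ℝ} (h : HasSideLimits (signY f x) y l r) :
    l ∈ Icc (-1 : ℝ) 1 ∧ r ∈ Icc (-1 : ℝ) 1 :=
  ⟨isClosed_Icc.mem_of_tendsto h.1 (Eventually.of_forall signY_mem_Icc),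
    isClosed_Icc.mem_of_tendsto h.2 (Eventually.of_forall signY_mem_Icc)⟩

/-- `f(x, ·)` goes from negative to positive values in `[p, q]`, with the zero `g x`. -/
def CrossesUp (f : (Fin n → ℝ) × ℝ → ℝ) (p q : ℝ) (g : (Fin n → ℝ) → ℝ) (x : Fin n → ℝ) : Prop :=
  (∀ y ∈ Ioc (g x) q, 0 < f (x, y)) ∧ ∀ y ∈ Ico p (g x), f (x, y) < 0

/-- `f(x, ·)` goes from positive to negative values in `[p, q]`, with the zero `g x`. -/
def CrossesDown (f : (Fin n → ℝ) × ℝ → ℝ) (p q : ℝ) (g : (Fin n → ℝ) → ℝ) (x : Fin n → ℝ) :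
    Prop :=
  (∀ y ∈ Ioc (g x) q, f (x, y) < 0) ∧ ∀ y ∈ Ico p (g x), 0 < f (x, y)

theorem IsImplicitFunction.ne_zero (hg : IsImplicitFunction f p q g) (hx : x ∈ cube n 1) :
    (∀ y ∈ Ioc (g x) q, f (x, y) ≠ 0) ∧ ∀ y ∈ Ico p (g x), f (x, y) ≠ 0 := by
  obtain ⟨hI, h⟩ := hg x hx
  refine ⟨fun y hy h0 => ?_, fun y hy h0 => ?_⟩
  · exact hy.1.ne' ((h y ⟨hI.1.trans hy.1.le, hy.2⟩).1 h0)
  · exact hy.2.ne ((h y ⟨hy.1, hy.2.le.trans hI.2⟩).1 h0)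

theorem IsImplicitFunction.apply_eq_zero (hg : IsImplicitFunction f p q g) (hx : x ∈ cube n 1) :
    f (x, g x) = 0 :=
  ((hg x hx).2 _ (hg x hx).1).2 rfl

/-- Right of `g x`, the sign is constant and equal to the right limit. -/
theorem right_alternative (hf : Continuous f) (hg : IsImplicitFunction f p q g)
    (hx : x ∈ cube n 1) {l r : ℝ} (h : HasSideLimits (signY f x) (g x) l r) (hq : g x < q) :
    (r = 1 ∧ ∀ y ∈ Ioc (g x) q, 0 < f (x, y)) ∨ (r = -1 ∧ ∀ y ∈ Ioc (g x) q, f (x, y) < 0) := by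
  have h0 := (hg.ne_zero hx).1
  have hq' : q ∈ Ioc (g x) q := ⟨hq, le_rfl⟩
  have hmem : Ioc (g x) q ∈ 𝓝[>] (g x) := Ioc_mem_nhdsGT hq
  rcases lt_or_gt_of_ne (h0 q hq') with hs | hs
  · have hall := neg_of_neg_of_ne_zero (continuous_section hf x) isPreconnected_Ioc h0 hq' hs
    refine Or.inr ⟨tendsto_nhds_unique h.2 (tendsto_const_nhds.congr' ?_), hall⟩
    filter_upwards [hmem] with y hy using (signY_of_neg (hall y hy)).symm
  · have hall := pos_of_pos_of_ne_zero (continuous_section hf x) isPreconnected_Ioc h0 hq' hs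
    refine Or.inl ⟨tendsto_nhds_unique h.2 (tendsto_const_nhds.congr' ?_), hall⟩
    filter_upwards [hmem] with y hy using (signY_of_nonneg (hall y hy).le).symm

/-- Left of `g x`, the sign is constant and equal to the left limit. -/
theorem left_alternative (hf : Continuous f) (hg : IsImplicitFunction f p q g)
    (hx : x ∈ cube n 1) {l r : ℝ} (h : HasSideLimits (signY f x) (g x) l r) (hp : p < g x) :
    (l = 1 ∧ ∀ y ∈ Ico p (g x), 0 < f (x, y)) ∨ (l = -1 ∧ ∀ y ∈ Ico p (g x), f (x, y) < 0) := by
  have h0 := (hg.ne_zero hx).2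
  have hp' : p ∈ Ico p (g x) := ⟨le_rfl, hp⟩
  have hmem : Ico p (g x) ∈ 𝓝[<] (g x) := Ico_mem_nhdsLT hp
  rcases lt_or_gt_of_ne (h0 p hp') with hs | hs
  · have hall := neg_of_neg_of_ne_zero (continuous_section hf x) isPreconnected_Ico h0 hp' hs
    refine Or.inr ⟨tendsto_nhds_unique h.1 (tendsto_const_nhds.congr' ?_), hall⟩
    filter_upwards [hmem] with y hy using (signY_of_neg (hall y hy)).symm
  · have hall := pos_of_pos_of_ne_zero (continuous_section hf x) isPreconnected_Ico h0 hp' hs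
    refine Or.inl ⟨tendsto_nhds_unique h.1 (tendsto_const_nhds.congr' ?_), hall⟩
    filter_upwards [hmem] with y hy using (signY_of_nonneg (hall y hy).le).symm

/-- A right limit `-1` or a left limit `1` would force the other limit out of `[-1, 1]`. Nothing
more is needed about that other limit, which is taken outside `[p, q]` if `g x` is an endpoint. -/
theorem crossesUp_of_lt (hf : Continuous f) (hg : IsImplicitFunction f p q g)
    (hx : x ∈ cube n 1) {l r : ℝ} (h : HasSideLimits (signY f x) (g x) l r) (hlr : l < r) :
    CrossesUp f p q g x := by
  obtain ⟨hl, hr⟩ := h.mem_Icc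
  refine ⟨fun y hy => ?_, fun y hy => ?_⟩
  · rcases right_alternative hf hg hx h (hy.1.trans_le hy.2) with h1 | h1
    · exact h1.2 y hy
    · linarith [hl.1, h1.1]
  · rcases left_alternative hf hg hx h (hy.1.trans_lt hy.2) with h1 | h1
    · linarith [hr.2, h1.1]
    · exact h1.2 y hy

theorem crossesDown_of_lt (hf : Continuous f) (hg : IsImplicitFunction f p q g)
    (hx : x ∈ cube n 1) {l r : ℝ} (h : HasSideLimits (signY f x) (g x) l r) (hlr : r < l) :
    CrossesDown f p q g x := by
  obtain ⟨hl, hr⟩ := h.mem_Icc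
  refine ⟨fun y hy => ?_, fun y hy => ?_⟩
  · rcases right_alternative hf hg hx h (hy.1.trans_le hy.2) with h1 | h1
    · linarith [hl.2, h1.1]
    · exact h1.2 y hy
  · rcases left_alternative hf hg hx h (hy.1.trans_lt hy.2) with h1 | h1
    · exact h1.2 y hy
    · linarith [hr.1, h1.1]

/-- The points where the boundary values of `f(x, ·)` exclude a downward crossing. -/
def upSet (f : (Fin n → ℝ) × ℝ → ℝ) (p q : ℝ) : Set (Fin n → ℝ) :=
  {x | 0 < f (x, q)} ∪ {x | f (x, p) < 0}

/-- The points where the boundary values of `f(x, ·)` exclude an upward crossing. -/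
def downSet (f : (Fin n → ℝ) × ℝ → ℝ) (p q : ℝ) : Set (Fin n → ℝ) :=
  {x | f (x, q) < 0} ∪ {x | 0 < f (x, p)}

theorem isOpen_upSet (hf : Continuous f) : IsOpen (upSet f p q) :=
  (isOpen_lt continuous_const (hf.comp (by fun_prop))).union
    (isOpen_lt (hf.comp (by fun_prop)) continuous_const)

theorem isOpen_downSet (hf : Continuous f) : IsOpen (downSet f p q) :=
  (isOpen_lt (hf.comp (by fun_prop)) continuous_const).union
    (isOpen_lt continuous_const (hf.comp (by fun_prop)))

/-- As `p < q`, the zero `g x` misses at least one endpoint, and `f(x, ·)` has a strict sign there.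
-/
theorem cube_subset_upSet_union_downSet (hg : IsImplicitFunction f p q g) (hpq : p < q) :
    cube n 1 ⊆ upSet f p q ∪ downSet f p q := by
  intro x hx
  obtain ⟨h1, h2⟩ := hg.ne_zero hx
  obtain ⟨hI, -⟩ := hg x hx
  rcases hI.2.lt_or_eq with hq | hq
  · rcases lt_or_gt_of_ne (h1 q ⟨hq, le_rfl⟩) with h | h
    · exact Or.inr (Or.inl h)
    · exact Or.inl (Or.inl h)
  · rcases lt_or_gt_of_ne (h2 p ⟨le_rfl, by linarith⟩) with h | h
    · exact Or.inl (Or.inr h)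
    · exact Or.inr (Or.inr h)

theorem CrossesUp.notMem_downSet (h : CrossesUp f p q g x) (hg : IsImplicitFunction f p q g)
    (hx : x ∈ cube n 1) : x ∉ downSet f p q := by
  have hI := (hg x hx).1
  have h0 := hg.apply_eq_zero hx
  rintro (hq | hp)
  · have hne : g x ≠ q := fun he => by
      rw [mem_ofPred_eq, ← he, h0] at hq; exact lt_irrefl _ hq
    exact lt_asymm hq (h.1 q ⟨lt_of_le_of_ne hI.2 hne, le_rfl⟩)
  · have hne : g x ≠ p := fun he => by
      rw [mem_ofPred_eq, ← he, h0] at hp; exact lt_irrefl _ hp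
    exact lt_asymm hp (h.2 p ⟨le_rfl, lt_of_le_of_ne hI.1 hne.symm⟩)

theorem CrossesDown.notMem_upSet (h : CrossesDown f p q g x) (hg : IsImplicitFunction f p q g)
    (hx : x ∈ cube n 1) : x ∉ upSet f p q := by
  have hI := (hg x hx).1
  have h0 := hg.apply_eq_zero hx
  rintro (hq | hp)
  · have hne : g x ≠ q := fun he => by
      rw [mem_ofPred_eq, ← he, h0] at hq; exact lt_irrefl _ hq
    exact lt_asymm hq (h.1 q ⟨lt_of_le_of_ne hI.2 hne, le_rfl⟩)
  · have hne : g x ≠ p := fun he => by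
      rw [mem_ofPred_eq, ← he, h0] at hp; exact lt_irrefl _ hp
    exact lt_asymm hp (h.2 p ⟨le_rfl, lt_of_le_of_ne hI.1 hne.symm⟩)

theorem CrossesUp.integral_heavisideY (h : CrossesUp f p q g x) (hg : IsImplicitFunction f p q g)
    (hx : x ∈ cube n 1) : ∫ y in Icc p q, heavisideY f (x, y) = q - g x := by
  have hI := (hg x hx).1
  have h0 := hg.apply_eq_zero hx
  have hcongr : ∀ y ∈ Icc p q, heavisideY f (x, y) = (Icc (g x) q).indicator 1 y := by
    intro y hy
    rcases lt_trichotomy y (g x) with hlt | rfl | hgt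
    · rw [indicator_of_notMem fun hm => not_le.2 hlt hm.1]
      simp [heavisideY, h.2 y ⟨hy.1, hlt⟩]
    · rw [indicator_of_mem (left_mem_Icc.2 hI.2)]
      simp [heavisideY, h0]
    · rw [indicator_of_mem (show y ∈ Icc (g x) q from ⟨hgt.le, hy.2⟩)]
      simp [heavisideY, (h.1 y ⟨hgt, hy.2⟩).le]
  rw [setIntegral_congr_fun measurableSet_Icc hcongr, setIntegral_indicator measurableSet_Icc,
    inter_eq_self_of_subset_right (Icc_subset_Icc_left hI.1)]
  simp [hI.2]

theorem CrossesDown.integral_heavisideY (h : CrossesDown f p q g x)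
    (hg : IsImplicitFunction f p q g) (hx : x ∈ cube n 1) :
    ∫ y in Icc p q, heavisideY f (x, y) = g x - p := by
  have hI := (hg x hx).1
  have h0 := hg.apply_eq_zero hx
  have hcongr : ∀ y ∈ Icc p q, heavisideY f (x, y) = (Icc p (g x)).indicator 1 y := by
    intro y hy
    rcases lt_trichotomy y (g x) with hlt | rfl | hgt
    · rw [indicator_of_mem (show y ∈ Icc p (g x) from ⟨hy.1, hlt.le⟩)]
      simp [heavisideY, (h.2 y ⟨hy.1, hlt⟩).le]
    · rw [indicator_of_mem (right_mem_Icc.2 hI.1)]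
      simp [heavisideY, h0]
    · rw [indicator_of_notMem fun hm => not_le.2 hgt hm.2]
      simp [heavisideY, h.1 y ⟨hgt, hy.2⟩]
  rw [setIntegral_congr_fun measurableSet_Icc hcongr, setIntegral_indicator measurableSet_Icc,
    inter_eq_self_of_subset_right (Icc_subset_Icc_right hI.2)]
  simp [hI.1]

theorem convex_cube (n : ℕ) (r : ℝ) : Convex ℝ (cube n r) := convex_Icc _ _

theorem measurableSet_cube (n : ℕ) (r : ℝ) : MeasurableSet (cube n r) := measurableSet_Icc

theorem isCompact_cube (n : ℕ) (r : ℝ) : IsCompact (cube n r) := isCompact_Icc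

/-- A property that holds almost everywhere on the cube holds somewhere on each nonempty
relatively open subset. -/
theorem exists_of_ae_cube {P : (Fin n → ℝ) → Prop}
    (hP : ∀ᵐ x ∂(volume.restrict (cube n 1)), P x) {U : Set (Fin n → ℝ)} (hU : IsOpen U)
    (hne : (cube n 1 ∩ U).Nonempty) : ∃ x ∈ cube n 1 ∩ U, P x := by
  have hint : (interior (cube n 1)).Nonempty := by
    refine ⟨0, mem_interior.2 ⟨univ.pi fun _ => Ioo (-1) 1, fun x hx => ?_,
      isOpen_set_pi finite_univ fun _ _ => isOpen_Ioo, by simp⟩⟩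
    exact ⟨fun k => (hx k trivial).1.le, fun k => (hx k trivial).2.le⟩
  obtain ⟨z, hz, hzU⟩ := hne
  -- A convex set with nonempty interior lies in the closure of that interior, so `U` meets the
  -- interior in a nonempty open set, which has positive measure.
  have hz' : z ∈ closure (interior (cube n 1)) := by
    rw [(convex_cube n 1).closure_interior_eq_closure_of_nonempty_interior hint]
    exact subset_closure hz
  have hne' : (U ∩ interior (cube n 1)).Nonempty := mem_closure_iff.1 hz' U hU hzU
  have hpos : 0 < volume (U ∩ interior (cube n 1)) :=
    (hU.inter isOpen_interior).measure_pos _ hne'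
  rw [ae_restrict_iff' (measurableSet_cube n 1)] at hP
  by_contra hcon
  push Not at hcon
  refine hpos.ne' (measure_mono_null (fun x hx => ?_) (ae_iff.1 hP))
  have hxc := interior_subset hx.2
  exact fun hx' => hcon x ⟨hxc, hx.1⟩ (hx' hxc)

/-- The direction of the crossing is the same almost everywhere, and it is given by the
orientation. -/
theorem orientation_alternative (hf : Continuous f) (hpq : p < q) (hjump : OneJump f p q)
    (hg : IsImplicitFunction f p q g) :
    (orientation f p q = 1 ∧ ∀ᵐ x ∂(volume.restrict (cube n 1)), CrossesUp f p q g x) ∨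
      (orientation f p q = -1 ∧ ∀ᵐ x ∂(volume.restrict (cube n 1)), CrossesDown f p q g x) := by
  have hloc : ∀ x ∈ cube n 1, ∀ y ∈ Icc p q, HasJumpAt (signY f x) y → y = g x :=
    fun x hx y hy h => ((hg x hx).2 y hy).1 (eq_zero_of_hasJumpAt hf h)
  have hboth : ∀ᵐ x ∂(volume.restrict (cube n 1)), x ∈ cube n 1 ∧
      ((HasUpJumpAt (signY f x) (g x) ∧ CrossesUp f p q g x) ∨ CrossesDown f p q g x) := by
    filter_upwards [hjump, ae_restrict_mem (measurableSet_cube n 1)] with x hx hxc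
    obtain ⟨y, ⟨hy, hj⟩, -⟩ := hx
    have hyg := hloc x hxc y hy hj
    subst hyg
    obtain ⟨l, r, hlr, hne⟩ := hj
    rcases lt_or_gt_of_ne hne with h | h
    · exact ⟨hxc, Or.inl ⟨⟨l, r, hlr, h⟩, crossesUp_of_lt hf hg hxc hlr h⟩⟩
    · exact ⟨hxc, Or.inr (crossesDown_of_lt hf hg hxc hlr h)⟩
  by_cases hup : ∃ x ∈ cube n 1, ∃ y ∈ Icc p q, HasUpJumpAt (signY f x) y
  · refine Or.inl ⟨by simp only [orientation, if_pos hup], ?_⟩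
    obtain ⟨x₀, hx₀, y, hy, l, r, hlr, hlt⟩ := hup
    have hyg := hloc x₀ hx₀ y hy ⟨l, r, hlr, hlt.ne⟩
    subst hyg
    -- The point `x₀` may belong to the exceptional null set; membership in an open set is what
    -- carries its direction over to almost every point.
    have hx₀' : x₀ ∈ upSet f p q :=
      (cube_subset_upSet_union_downSet hg hpq hx₀).resolve_right
        ((crossesUp_of_lt hf hg hx₀ hlr hlt).notMem_downSet hg hx₀)
    filter_upwards [hboth] with x hx
    refine hx.2.elim (fun h => h.2) fun hdown => ?_
    exfalso
    have hx' : x ∈ downSet f p q :=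
      (cube_subset_upSet_union_downSet hg hpq hx.1).resolve_left (hdown.notMem_upSet hg hx.1)
    -- If both directions occurred, connectedness would make the two open sets overlap inside the
    -- cube. The overlap contains a point with a genuine crossing, and either direction excludes one
    -- of the sets.
    have hne := (convex_cube n 1).isPreconnected _ _ (isOpen_upSet hf) (isOpen_downSet hf)
      (cube_subset_upSet_union_downSet hg hpq) ⟨x₀, hx₀, hx₀'⟩ ⟨x, hx.1, hx'⟩
    obtain ⟨z, ⟨hzc, hzU, hzD⟩, hz⟩ :=
      exists_of_ae_cube hboth ((isOpen_upSet hf).inter (isOpen_downSet hf)) hne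
    exact hz.2.elim (fun h => h.2.notMem_downSet hg hzc hzD) fun h => h.notMem_upSet hg hzc hzU
  · refine Or.inr ⟨by simp only [orientation, if_neg hup], ?_⟩
    filter_upwards [hboth] with x hx
    exact hx.2.resolve_left fun h => hup ⟨x, hx.1, g x, (hg x hx.1).1, h.1⟩

theorem measurable_heavisideY (hf : Continuous f) : Measurable (heavisideY f) :=
  Measurable.ite (isClosed_le continuous_const hf).measurableSet measurable_const measurable_const

theorem blockVolume_eq {N : ℕ} (hf : Continuous f) (α : Fin n → Fin N) :
    blockVolume f p q α = ∫ x in gridBlock α, ∫ y in Icc p q, heavisideY f (x, y) := by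
  have hint : IntegrableOn (heavisideY f) (gridBlock α ×ˢ Icc p q) (volume.prod volume) := by
    refine Measure.integrableOn_of_bounded (M := 1)
      ((gridBlock_isCompact α).prod isCompact_Icc).measure_lt_top.ne
      (measurable_heavisideY hf).aestronglyMeasurable (Eventually.of_forall fun z => ?_)
    unfold heavisideY
    split_ifs <;> simp
  exact setIntegral_prod _ hint

/-- The data computed from `f` are the integrals of the implicit function over the blocks. -/
theorem blockData_eq_setIntegral {N : ℕ} (hf : Continuous f) (hpq : p ≤ q)
    (hjump : OneJump f p q) (hg : IsImplicitFunction f p q g)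
    (hgi : IntegrableOn g (cube n 1)) (α : Fin n → Fin N) :
    blockData f p q N α = ∫ x in gridBlock α, g x := by
  have hsub := gridBlock_subset_cube α
  have hms : MeasurableSet (gridBlock α) := (gridBlock_isCompact α).measurableSet
  have hgα : IntegrableOn g (gridBlock α) := hgi.mono_set hsub
  have hconst : ∀ c : ℝ, IntegrableOn (fun _ : Fin n → ℝ => c) (gridBlock α) := fun c =>
    integrableOn_const (gridBlock_isCompact α).measure_lt_top.ne
  unfold blockData
  rcases hpq.lt_or_eq with hlt | rfl
  · rcases orientation_alternative hf hlt hjump hg with ⟨ho, h⟩ | ⟨ho, h⟩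
    · have h1 : blockVolume f p q α = ∫ x in gridBlock α, (q - g x) := by
        rw [blockVolume_eq hf]
        refine setIntegral_congr_ae hms ?_
        rw [ae_restrict_iff' (measurableSet_cube n 1)] at h
        filter_upwards [h] with x hx hxα
        exact (hx (hsub hxα)).integral_heavisideY hg (hsub hxα)
      rw [h1, integral_sub (hconst q) hgα, setIntegral_const, ho, smul_eq_mul]
      ring
    · have h1 : blockVolume f p q α = ∫ x in gridBlock α, (g x - p) := by
        rw [blockVolume_eq hf]
        refine setIntegral_congr_ae hms ?_
        rw [ae_restrict_iff' (measurableSet_cube n 1)] at h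
        filter_upwards [h] with x hx hxα
        exact (hx (hsub hxα)).integral_heavisideY hg (hsub hxα)
      rw [h1, integral_sub hgα (hconst p), setIntegral_const, ho, smul_eq_mul]
      ring
  -- For a degenerate interval the volume term vanishes and the orientation cancels from the other
  -- two.
  · have h1 : blockVolume f p p α = 0 := by
      rw [blockVolume_eq hf]
      simp
    have h2 : ∫ x in gridBlock α, g x = ∫ x in gridBlock α, p := by
      refine setIntegral_congr_fun hms fun x hx => ?_
      have := (hg x (hsub hx)).1
      exact le_antisymm this.2 this.1
    rw [h1, h2, setIntegral_const, smul_eq_mul]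
    ring

end Jump

/-! ### Approximation of monomials and linearity in the data -/

theorem coeffTensor_eq {n : ℕ} (f : (Fin n → ℝ) × ℝ → ℝ) (p q : ℝ) (N : ℕ) :
    coeffTensor f p q N = wTensor n N * kron (fun _ => (vMatrix N)⁻¹) (blockData f p q N) := by
  rw [coeffTensor, foldl_contract_finRange]

/-- The polynomial in one variable, of degree less than `N`, with the same integrals over the grid
intervals as `x ^ m`. -/
def gridApprox (N m : ℕ) (x : ℝ) : ℝ :=
  ∑ j : Fin N, ((j : ℕ) + 1 : ℝ) * ((vMatrix N)⁻¹.mulVec fun i : Fin N => gridMoment N m i) j *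
    x ^ (j : ℕ)

/-- Invertibility of `V_N` identifies the solution built by interpolation with the one given by the
inverse matrix. -/
theorem exists_gridApprox_bound {ρ : ℝ} (hρ : 1 < ρ) :
    ∃ K : ℝ, 0 ≤ K ∧ ∀ N : ℕ, 0 < N → ∀ m : ℕ,
      (∀ x : ℝ, |x| ≤ 1 → |gridApprox N m x| ≤ K * ρ ^ m) ∧
      (m < N → ∀ x : ℝ, gridApprox N m x = x ^ m) := by
  obtain ⟨K, hK, h⟩ := exists_moment_solution hρ
  refine ⟨K, hK, fun N hN m => ?_⟩
  obtain ⟨e, he, hbd, hlow⟩ := h N hN m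
  have hdet := (Matrix.isUnit_iff_isUnit_det _).1 (isUnit_vMatrix hN)
  have hu : (vMatrix N).mulVec e = fun i : Fin N => gridMoment N m i := funext he
  have hinv : (vMatrix N)⁻¹.mulVec (fun i : Fin N => gridMoment N m i) = e := by
    rw [← hu, Matrix.mulVec_mulVec, Matrix.nonsing_inv_mul _ hdet, Matrix.one_mulVec]
  unfold gridApprox
  rw [hinv]
  exact ⟨hbd, hlow⟩

/-- The approximation of a monomial in several variables is the product of approximations. -/
theorem tensorPoly_kron_prod {n N : ℕ} (γ : Fin n → ℕ) (x : Fin n → ℝ) :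
    tensorPoly (wTensor n N * kron (fun _ => (vMatrix N)⁻¹)
      fun α => ∏ k, gridMoment N (γ k) (α k)) x = ∏ k, gridApprox N (γ k) (x k) := by
  simp only [tensorPoly, gridApprox, Fintype.prod_sum]
  refine Finset.sum_congr rfl fun β _ => ?_
  rw [Pi.mul_apply, kron_prod (vMatrix N)⁻¹ (fun k i => gridMoment N (γ k) i), wTensor,
    monomialFun, ← Finset.prod_mul_distrib, ← Finset.prod_mul_distrib]

/-- The value at `x` is a finite linear combination of the data, so it commutes with infinite sums.
-/
theorem hasSum_tensorPoly_kron {ι : Type*} {n N : ℕ} (A : Fin n → Matrix (Fin N) (Fin N) ℝ)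
    (c : ι → ℝ) (e : ι → (Fin n → Fin N) → ℝ) (d : (Fin n → Fin N) → ℝ)
    (h : ∀ α, HasSum (fun i => c i * e i α) (d α)) (x : Fin n → ℝ) :
    HasSum (fun i => c i * tensorPoly (wTensor n N * kron A (e i)) x)
      (tensorPoly (wTensor n N * kron A d) x) := by
  unfold tensorPoly kron
  have h1 := hasSum_sum (s := Finset.univ) fun (β : Fin n → Fin N) _ =>
    ((hasSum_sum (s := Finset.univ) fun (α : Fin n → Fin N) _ =>
      (h α).mul_left (∏ k, A k (β k) (α k))).mul_left (wTensor n N β)).mul_right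
        (monomialFun (fun k => (β k : ℕ)) x)
  convert! h1 using 1
  funext i
  simp only [Pi.mul_apply, Finset.mul_sum, Finset.sum_mul]
  refine Finset.sum_congr rfl fun β _ => Finset.sum_congr rfl fun α _ => ?_
  ring

/-! ### Power series and dominated convergence -/

section Series

variable {n : ℕ} {g : (Fin n → ℝ) → ℝ} {ρ : ℝ} {c : (Fin n → ℕ) → ℝ}

theorem abs_le_of_mem_cube {r : ℝ} {x : Fin n → ℝ} (hx : x ∈ cube n r) (k : Fin n) : |x k| ≤ r :=
  abs_le.2 ⟨hx.1 k, hx.2 k⟩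

theorem abs_monomialFun_le (hρ : 1 ≤ ρ) {x : Fin n → ℝ} (hx : x ∈ cube n 1) (β : Fin n → ℕ) :
    |monomialFun β x| ≤ ∏ k, ρ ^ β k := by
  rw [monomialFun, Finset.abs_prod]
  refine Finset.prod_le_prod (fun _ _ => abs_nonneg _) fun k _ => ?_
  rw [abs_pow]
  exact pow_le_pow_left₀ (abs_nonneg _) ((abs_le_of_mem_cube hx k).trans hρ) _

/-- Evaluate at the corner `(ρ, …, ρ)`: unconditional convergence in `ℝ` is absolute. -/
theorem summable_abs_of_hasSum (hρ : 1 ≤ ρ)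
    (hc : ∀ x ∈ cube n ρ, HasSum (fun β => c β * monomialFun β x) (g x)) :
    Summable fun β => |c β| * ∏ k, ρ ^ β k := by
  have h := (hc (fun _ => ρ) ⟨fun _ => by linarith, fun _ => le_rfl⟩).summable.abs
  refine h.congr fun β => ?_
  rw [abs_mul, monomialFun, abs_of_nonneg (show 0 ≤ ∏ k, ρ ^ β k from
    Finset.prod_nonneg fun k _ => by positivity)]

theorem cube_subset (hρ : 1 ≤ ρ) : cube n 1 ⊆ cube n ρ :=
  Icc_subset_Icc (fun _ => neg_le_neg hρ) fun _ => hρ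

theorem continuousOn_of_hasSum (hρ : 1 ≤ ρ)
    (hc : ∀ x ∈ cube n ρ, HasSum (fun β => c β * monomialFun β x) (g x)) :
    ContinuousOn g (cube n 1) := by
  refine (continuousOn_tsum (f := fun β x => c β * monomialFun β x)
    (fun β => (continuous_const.mul (continuous_monomialFun β)).continuousOn)
    (summable_abs_of_hasSum hρ hc) fun β x hx => ?_).congr fun x hx =>
      (hc x (cube_subset hρ hx)).tsum_eq.symm
  rw [Real.norm_eq_abs, abs_mul]
  exact mul_le_mul_of_nonneg_left (abs_monomialFun_le hρ hx β) (abs_nonneg _)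

theorem hasSum_setIntegral_gridBlock (hρ : 1 ≤ ρ)
    (hc : ∀ x ∈ cube n ρ, HasSum (fun β => c β * monomialFun β x) (g x)) {N : ℕ}
    (α : Fin n → Fin N) :
    HasSum (fun β => c β * ∏ k, gridMoment N (β k) (α k)) (∫ x in gridBlock α, g x) := by
  have hms : MeasurableSet (gridBlock α) := (gridBlock_isCompact α).measurableSet
  have h := hasSum_integral_of_dominated_convergence (μ := volume.restrict (gridBlock α))
    (F := fun β x => c β * monomialFun β x) (f := g) (fun β _ => |c β| * ∏ k, ρ ^ β k)
    (fun β => (continuous_const.mul (continuous_monomialFun β)).aestronglyMeasurable)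
    (fun β => by
      filter_upwards [ae_restrict_mem hms] with x hx
      rw [Real.norm_eq_abs, abs_mul]
      exact mul_le_mul_of_nonneg_left (abs_monomialFun_le hρ (gridBlock_subset_cube α hx) β)
        (abs_nonneg _))
    (Eventually.of_forall fun _ => summable_abs_of_hasSum hρ hc)
    (integrableOn_const (gridBlock_isCompact α).measure_lt_top.ne)
    (by
      filter_upwards [ae_restrict_mem hms] with x hx
      exact hc x (cube_subset hρ (gridBlock_subset_cube α hx)))
  simpa only [integral_const_mul, setIntegral_monomialFun] using h

/-- The polynomials with the same integrals over the blocks as `g` are uniformly bounded and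
converge to `g` on the cube. -/
theorem tensorPoly_bounded_and_tendsto (hρ : 1 < ρ)
    (hc : ∀ x ∈ cube n ρ, HasSum (fun β => c β * monomialFun β x) (g x)) :
    ∃ B : ℝ, ∀ x ∈ cube n 1,
      (∀ N : ℕ, 0 < N → |tensorPoly (wTensor n N * kron (fun _ => (vMatrix N)⁻¹)
        fun α => ∫ z in gridBlock α, g z) x| ≤ B) ∧
      Tendsto (fun N : ℕ => tensorPoly (wTensor n N * kron (fun _ => (vMatrix N)⁻¹)
        fun α => ∫ z in gridBlock α, g z) x) atTop (𝓝 (g x)) := by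
  obtain ⟨K, hK, hK'⟩ := exists_gridApprox_bound hρ
  have hsum : Summable fun β : Fin n → ℕ => K ^ n * (|c β| * ∏ k, ρ ^ β k) :=
    (summable_abs_of_hasSum hρ.le hc).mul_left _
  refine ⟨∑' β : Fin n → ℕ, K ^ n * (|c β| * ∏ k, ρ ^ β k), fun x hx => ?_⟩
  -- Integrating the series of `g` block by block and solving the moment problem termwise replaces
  -- each monomial by the product of its one-variable approximations.
  have hrep : ∀ N : ℕ, HasSum (fun β => c β * ∏ k, gridApprox N (β k) (x k))
      (tensorPoly (wTensor n N * kron (fun _ => (vMatrix N)⁻¹)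
        fun α => ∫ z in gridBlock α, g z) x) := by
    intro N
    simpa only [tensorPoly_kron_prod] using hasSum_tensorPoly_kron (fun _ => (vMatrix N)⁻¹) c
      (fun β α => ∏ k, gridMoment N (β k) (α k)) _ (hasSum_setIntegral_gridBlock hρ.le hc) x
  have hbd : ∀ N : ℕ, 0 < N → ∀ β : Fin n → ℕ, ‖c β * ∏ k, gridApprox N (β k) (x k)‖ ≤
      K ^ n * (|c β| * ∏ k, ρ ^ β k) := by
    intro N hN β
    rw [Real.norm_eq_abs, abs_mul, Finset.abs_prod]
    calc |c β| * ∏ k, |gridApprox N (β k) (x k)| ≤ |c β| * ∏ k, (K * ρ ^ β k) := by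
          gcongr with k _
          exact (hK' N hN (β k)).1 _ (abs_le_of_mem_cube hx k)
      _ = _ := by
          rw [Finset.prod_mul_distrib, Finset.prod_const, Finset.card_univ, Fintype.card_fin]
          ring
  refine ⟨fun N hN => ?_, ?_⟩
  · rw [← (hrep N).tsum_eq]
    exact tsum_of_norm_bounded hsum.hasSum (hbd N hN)
  · rw [← (hc x (cube_subset hρ.le hx)).tsum_eq]
    simp_rw [← (hrep _).tsum_eq]
    refine tendsto_tsum_of_dominated_convergence hsum (fun β => ?_) ?_
    -- Once `N` exceeds every `β k`, the term is exactly that of `g`.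
    · refine tendsto_const_nhds.congr' ?_
      filter_upwards [eventually_gt_atTop (∑ k, β k)] with N hN
      rw [monomialFun]
      congr 1
      refine Finset.prod_congr rfl fun k _ => ?_
      have hk : β k ≤ ∑ k, β k := Finset.single_le_sum (fun _ _ => Nat.zero_le _) (Finset.mem_univ k)
      exact ((hK' N (by omega) (β k)).2 (by omega) _).symm
    · filter_upwards [eventually_gt_atTop 0] with N hN using hbd N hN

end Series

/-! ### Weak-star convergence -/

/-- A sequence of functions that is bounded on a compact set and converges there pointwise
converges weak-star in `L^∞`. -/
theorem tendstoWeakStarLInfty_of_tendsto {X : Type*} [TopologicalSpace X] [MeasurableSpace X]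
    [BorelSpace X] [SecondCountableTopology X] {μ : Measure X} {s : Set X} (hs : IsCompact s)
    (hms : MeasurableSet s) {u : ℕ → X → ℝ} {v : X → ℝ} (hu : ∀ N, ContinuousOn (u N) s)
    (hv : ContinuousOn v s) {B : ℝ} (hB : ∀ N, 0 < N → ∀ x ∈ s, |u N x| ≤ B)
    (huv : ∀ x ∈ s, Tendsto (fun N => u N x) atTop (𝓝 (v x))) :
    TendstoWeakStarLInfty (μ.restrict s) u v := by
  have hmem : ∀ w : X → ℝ, ContinuousOn w s → MemLp w ⊤ (μ.restrict s) := by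
    intro w hw
    obtain ⟨C, hC⟩ := hs.exists_bound_of_continuousOn hw
    refine memLp_top_of_bound (hw.aestronglyMeasurable hms) C ?_
    filter_upwards [ae_restrict_mem hms] with x hx using hC x hx
  refine ⟨fun N => hmem _ (hu N), hmem _ hv, fun φ hφ => ?_⟩
  -- The bound is assumed only for `N > 0`, so the term `N = 0` is dropped.
  rw [← tendsto_add_atTop_iff_nat 1]
  refine tendsto_integral_of_dominated_convergence (fun x => B * ‖φ x‖)
    (fun N => ((hu (N + 1)).aestronglyMeasurable hms).mul hφ.aestronglyMeasurable)
    (hφ.norm.const_mul B) (fun N => ?_) ?_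
  · filter_upwards [ae_restrict_mem hms] with x hx
    rw [norm_mul]
    exact mul_le_mul_of_nonneg_right (hB _ N.succ_pos x hx) (norm_nonneg _)
  · filter_upwards [ae_restrict_mem hms] with x hx
    exact ((tendsto_add_atTop_iff_nat 1).2 (huv x hx)).mul_const _

end ImplicitWeakStar

end

open ImplicitWeakStar in
theorem theorem4p1 {n : ℕ} (f : (Fin n → ℝ) × ℝ → ℝ) (hf : Continuous f)
    (p q : ℝ) (hpq : p ≤ q) (hjump : OneJump f p q)
    (g : (Fin n → ℝ) → ℝ) (hg : IsImplicitFunction f p q g)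
    (hga : ∃ δ : ℝ, 0 < δ ∧ HasPowerSeriesOnCube g (1 + δ)) :
    (∀ N : ℕ, 0 < N → IsUnit (vMatrix N).det ∧
      ∀ c : (Fin n → Fin N) → ℝ,
        (∀ α : Fin n → Fin N, ∫ x in gridBlock α, tensorPoly c x = blockData f p q N α) ↔
          c = coeffTensor f p q N) ∧
    TendstoWeakStarLInfty (volume.restrict (cube n 1))
      (fun N => tensorPoly (coeffTensor f p q N)) g := by
  obtain ⟨δ, hδ, c, hc⟩ := hga
  have hρ : 1 < 1 + δ := by linarith
  refine ⟨fun N hN => ⟨(Matrix.isUnit_iff_isUnit_det _).1 (isUnit_vMatrix hN), fun c => ?_⟩, ?_⟩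
  · rw [coeffTensor_eq]
    exact setIntegral_tensorPoly_eq_iff hN c _
  · have hgc := continuousOn_of_hasSum hρ.le hc
    have hdata : ∀ N : ℕ, coeffTensor f p q N = wTensor n N *
        kron (fun _ => (vMatrix N)⁻¹) fun α => ∫ z in gridBlock α, g z := by
      intro N
      rw [coeffTensor_eq, funext fun α => blockData_eq_setIntegral hf hpq hjump hg
        (hgc.integrableOn_compact (isCompact_cube n 1)) α]
    obtain ⟨B, hB⟩ := tensorPoly_bounded_and_tendsto hρ hc
    simp_rw [hdata]
    exact tendstoWeakStarLInfty_of_tendsto (isCompact_cube n 1) (measurableSet_cube n 1)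
      (fun N => (continuous_tensorPoly _).continuousOn) hgc
      (fun N hN x hx => (hB x hx).1 N hN) fun x hx => (hB x hx).2
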